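/- Let $X_1, X_2, \ldots$ be independent identically distributed real random variables and let $X$ have their common distribution. Let $K$ and $m$ be fixed, and let $f_1, \ldots, f_m : \mathbb R \to \mathbb R$ be measurable functions with $\mathbb E[f_i(X)^4] < \infty$ and $\mathrm{Var}(f_i(X)) > 0$ for every $i$, and $\mathrm{Cov}(f_i(X), f_j(X)) = 0$ for all $i \ne j$. For $f, g \in \{f_1, \ldots, f_m\}$, a sample size $N$ and a lag $k$ with $1 \le k < N$, put $$\hat m(f) = \frac1N\sum_{i=1}^N f(X_i), \qquad \hat s(f) = \Bigl[\frac1N\sum_{i=1}^N \bigl(f(X_i)-\hat m(f)\bigr)^2\Bigr]^{1/2},$$ $$\hat\gamma_k(f,g) = \frac1{N-k}\sum_{i=1}^{N-k}\bigl(f(X_i)-\hat m(f)\bigr)\bigl(g(X_{i+k})-\hat m(g)\bigr), \qquad \hat\rho_k(f,g) = \frac{\hat\gamma_k(f,g)}{\hat s(f)\,\hat s(g)},$$ where $\hat\rho_k(f,g)$ is set to $0$ if the denominator vanishes. Let $\hat{\mathbb C}_k = \bigl[\hat\rho_k(f_i,f_j),\ i,j=1,\ldots,m\bigr] \in \mathbb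 R^{m^2}$ and let $\|\cdot\|$ be the Euclidean norm. Fix a constant $c > 0$. Then the generalized Ljung–Box statistic $$\mathbb L_N := N(N+c)\sum_{k=1}^K \frac{\|\hat{\mathbb C}_k\|^2}{N-k}$$ converges weakly (in distribution), as $N \to \infty$, to $\chi^2_{m^2K}$, the chi-squared distribution with $m^2K$ degrees of freedom, that is, the law of the sum of squares of $m^2K$ independent standard normal random variables. -/

import Mathlib

open MeasureTheory ProbabilityTheory Filter

noncomputable section

namespace SerialTest

/-! In the sample definitions, `x : ℕ → ℝ` is a realized trajectory, numbered from `0`: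
the sample of size `N` is `x 0, …, x (N - 1)`, i.e. `x i` is the observation `X_{i+1}`. -/

/-- Empirical mean of `f` over the first `N` observations. -/
def empMean (x : ℕ → ℝ) (N : ℕ) (f : ℝ → ℝ) : ℝ :=
  (1 / (N : ℝ)) * ∑ i ∈ Finset.range N, f (x i)

/-- Empirical variance of `f` over the first `N` observations (normalized by `N`). -/
def empVar (x : ℕ → ℝ) (N : ℕ) (f : ℝ → ℝ) : ℝ :=
  (1 / (N : ℝ)) * ∑ i ∈ Finset.range N, (f (x i) - empMean x N f) ^ 2

/-- Empirical standard deviation of `f`. -/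
def empStd (x : ℕ → ℝ) (N : ℕ) (f : ℝ → ℝ) : ℝ :=
  Real.sqrt (empVar x N f)

/-- Empirical cross-covariance of `f` and `g` with time lag `k` (meaningful for `k < N`). -/
def empCrossCov (x : ℕ → ℝ) (N k : ℕ) (f g : ℝ → ℝ) : ℝ :=
  (1 / ((N : ℝ) - (k : ℝ))) *
    ∑ i ∈ Finset.range (N - k), (f (x i) - empMean x N f) * (g (x (i + k)) - empMean x N g)

/-- Empirical cross-correlation of `f` and `g` with time lag `k`. -/
def empCrossCorr (x : ℕ → ℝ) (N k : ℕ) (f g : ℝ → ℝ) : ℝ :=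
  empCrossCov x N k f g / (empStd x N f * empStd x N g)

/-- The vector in `ℝ^{m²}`, with its Euclidean norm, of all empirical auto- and
cross-correlations of `f₁, …, f_m` with time lag `k`. -/
def corrVector {m : ℕ} (f : Fin m → ℝ → ℝ) (x : ℕ → ℝ) (N k : ℕ) :
    EuclideanSpace ℝ (Fin m × Fin m) :=
  WithLp.toLp 2 fun ij => empCrossCorr x N k (f ij.1) (f ij.2)

/-- The generalized Ljung–Box statistic with lags `1, …, K` and constant `c`. -/
def ljungBox {m : ℕ} (f : Fin m → ℝ → ℝ) (K : ℕ) (c : ℝ) (x : ℕ → ℝ) (N : ℕ) : ℝ :=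
  (N : ℝ) * ((N : ℝ) + c) *
    ∑ k ∈ Finset.Icc 1 K, ‖corrVector f x N k‖ ^ 2 / ((N : ℝ) - (k : ℝ))

/-- The chi-squared distribution with `n` degrees of freedom: the law of the sum of squares
of `n` independent standard normal random variables. -/
def chiSquared (n : ℕ) : Measure ℝ :=
  (Measure.pi fun _ : Fin n => gaussianReal 0 1).map fun z => ∑ i, z i ^ 2

instance instIsProbabilityMeasureChiSquared (n : ℕ) :
    IsProbabilityMeasure (chiSquared n) :=
  Measure.isProbabilityMeasure_map
    (Finset.measurable_sum _ fun i _ => (measurable_pi_apply i).pow_const 2).aemeasurable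

end SerialTest

end

/-! The statistic does not change under increasing affine maps of the `f i`, so these may be
standardized to functions `g i` with `E g_i(X) = 0` and `E g_i(X) g_j(X) = δ_ij`. The lagged
products `g_i(X_t) g_j(X_{t+k})`, `1 ≤ k ≤ K`, are then orthonormal over all `(t, k, i, j)`
(`integral_lagged_mul`): an observation that enters through a single `g_i` has mean zero and is
independent of the rest.

A linear combination of these products is a stationary sequence in `t` whose terms depend on windows
of `K + 1` observations. Long blocks separated by gaps of length `K` are i.i.d., so the classical
CLT applies to them, and by orthogonality the gaps carry a share of the variance that vanishes as
the blocks grow (`tendsto_charFun_of_blocks`). Characteristic functions turn this into a standard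
Gaussian limit in dimension `m²K` (`tendstoInDistribution_laggedProducts`).

Empirical centering and truncation at `N - k` cost `O(N^(-1/2))` in `L¹`
(`integral_lagRemainder_le`). The statistic is a sum of squares of the centered sums with weights
tending to `1` almost surely by the strong law, so Slutsky and continuous mapping give the
chi-squared limit. -/

/-! ### Independent blocks, orthogonal sums and distances of characteristic functions. -/

section Blocks

open scoped Topology

namespace ProbabilityTheory

variable {Ω : Type*} [MeasurableSpace Ω] {μ : Measure Ω}

/-- Grouping an independent family indexed by pairs gives an independent family of tuples. -/
lemma iIndepFun.curry {ι κ E : Type*} [MeasurableSpace E] [IsProbabilityMeasure μ]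
    {X : ι × κ → Ω → E} (hX : ∀ p, Measurable (X p)) (h : iIndepFun X μ) :
    iIndepFun (fun (i : ι) ω (j : κ) => X (i, j) ω) μ := by
  have : ∀ p, IsProbabilityMeasure (μ.map (X p)) :=
    fun p => Measure.isProbabilityMeasure_map (hX p).aemeasurable
  have : ∀ (i : ι) (j : κ), IsProbabilityMeasure (μ.map (X (i, j))) := fun i j => this _
  rw [iIndepFun_iff_map_fun_eq_infinitePi_map (by fun_prop)]
  have hrow : ∀ i, μ.map (fun ω (j : κ) => X (i, j) ω)
      = Measure.infinitePi fun j => μ.map (X (i, j)) := fun i =>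
    iIndepFun.map_fun_eq_infinitePi_map (fun j => hX (i, j))
      (h.precomp (g := fun j => (i, j)) fun a b hab => (Prod.mk.inj hab).2)
  simp_rw [hrow]
  rw [← Measure.infinitePi_map_curry (fun i j => μ.map (X (i, j))),
    ← h.map_fun_eq_infinitePi_map hX, Measure.map_map (by fun_prop) (by fun_prop)]
  rfl

/-- Consecutive blocks of an independent sequence are independent. -/
lemma iIndepFun.blocks {E : Type*} [MeasurableSpace E] [IsProbabilityMeasure μ]
    {X : ℕ → Ω → E} (hX : ∀ n, Measurable (X n)) (h : iIndepFun X μ) (L : ℕ) :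
    iIndepFun (fun (q : ℕ) ω (r : Fin L) => X (q * L + r) ω) μ := by
  have hinj : Function.Injective fun p : ℕ × Fin L => p.1 * L + p.2 := by
    rintro ⟨a, b⟩ ⟨c, d⟩ hab
    simp only at hab
    have hL : 0 < L := b.pos
    have h1 : (a * L + b) / L = a := by
      rw [mul_comm, Nat.mul_add_div hL, Nat.div_eq_of_lt b.2, add_zero]
    have h2 : (c * L + d) / L = c := by
      rw [mul_comm, Nat.mul_add_div hL, Nat.div_eq_of_lt d.2, add_zero]
    have hac : a = c := by rw [← h1, ← h2, hab]
    subst hac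
    simpa [Fin.ext_iff] using hab
  exact iIndepFun.curry (X := fun p : ℕ × Fin L => X (p.1 * L + p.2)) (fun p => hX _)
    (h.precomp hinj)

/-- The law of a tuple of an i.i.d. sequence does not depend on the indices. -/
lemma IdentDistrib.tuple {E ι : Type*} [MeasurableSpace E] [Countable ι]
    {X : ℕ → Ω → E} (h : iIndepFun X μ) (hident : ∀ n, IdentDistrib (X n) (X 0) μ μ)
    {a b : ι → ℕ} (ha : Function.Injective a) (hb : Function.Injective b) :
    IdentDistrib (fun ω i => X (a i) ω) (fun ω i => X (b i) ω) μ μ :=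
  IdentDistrib.pi (fun i => (hident (a i)).trans (hident (b i)).symm)
    (h.precomp ha) (h.precomp hb)

/-- Second moment of a sum of orthogonal variables with the same second moment. -/
lemma integral_sq_sum_of_orthogonal {ι : Type*} [DecidableEq ι] {D : ι → Ω → ℝ} {v : ℝ}
    (hD : ∀ t, MemLp (D t) 2 μ)
    (horth : ∀ s t, ∫ ω, D s ω * D t ω ∂μ = if s = t then v else 0) (J : Finset ι) :
    ∫ ω, (∑ t ∈ J, D t ω) ^ 2 ∂μ = J.card * v := by
  have hint : ∀ s t, Integrable (fun ω => D s ω * D t ω) μ := fun s t => (hD s).integrable_mul (hD t)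
  simp_rw [sq, Finset.sum_mul_sum]
  rw [integral_finsetSum _ fun s _ => integrable_finsetSum _ fun t _ => hint s t]
  simp_rw [integral_finsetSum _ fun t _ => hint _ t, horth]
  simp

/-- Nonnegativity of the variance of `|Z|`. -/
lemma integral_abs_le_sqrt_integral_sq [IsProbabilityMeasure μ] {Z : Ω → ℝ} (hZ : MemLp Z 2 μ) :
    ∫ ω, |Z ω| ∂μ ≤ √(∫ ω, Z ω ^ 2 ∂μ) := by
  apply Real.le_sqrt_of_sq_le
  have h := variance_nonneg |Z| μ
  rw [variance_eq_sub hZ.abs] at h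
  simpa using h

/-- Characteristic functions of close variables are close. -/
lemma norm_charFun_sub_le [IsProbabilityMeasure μ] {Y Z : Ω → ℝ} (hY : MemLp Y 2 μ)
    (hZ : MemLp Z 2 μ) (u : ℝ) :
    ‖charFun (μ.map Y) u - charFun (μ.map Z) u‖ ≤ |u| * √(∫ ω, (Y ω - Z ω) ^ 2 ∂μ) := by
  have hYm := hY.aestronglyMeasurable.aemeasurable
  have hZm := hZ.aestronglyMeasurable.aemeasurable
  have hb : ∀ x : ℝ, ‖Complex.exp (u * x * Complex.I)‖ = 1 := fun x => by
    rw [← Complex.ofReal_mul, Complex.norm_exp_ofReal_mul_I]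
  have hi : ∀ W : Ω → ℝ, AEMeasurable W μ →
      Integrable (fun ω => Complex.exp (u * W ω * Complex.I)) μ := fun W hW =>
    Integrable.of_bound (C := 1) (by fun_prop) (ae_of_all _ fun ω => (hb _).le)
  have hYZ : MemLp (fun ω => Y ω - Z ω) 2 μ := hY.sub hZ
  rw [charFun_apply_real, charFun_apply_real, integral_map hYm (by fun_prop),
    integral_map hZm (by fun_prop), ← integral_sub (hi Y hYm) (hi Z hZm)]
  calc _ ≤ ∫ ω, |u| * |Y ω - Z ω| ∂μ := by
        refine norm_integral_le_of_norm_le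
          ((hYZ.integrable (by norm_num)).abs.const_mul _) (ae_of_all _ fun ω => ?_)
        -- Factoring out a unimodular number leaves `|exp(ix) - 1| ≤ |x|`.
        have : Complex.exp (u * Y ω * Complex.I) - Complex.exp (u * Z ω * Complex.I)
            = Complex.exp (u * Z ω * Complex.I) *
              (Complex.exp (Complex.I * ((u * (Y ω - Z ω) : ℝ) : ℂ)) - 1) := by
          rw [mul_sub, ← Complex.exp_add, mul_one]
          congr 2
          push_cast
          ring
        rw [this, norm_mul, hb, one_mul, ← abs_mul]
        exact Real.norm_exp_I_mul_ofReal_sub_one_le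
    _ = |u| * ∫ ω, |Y ω - Z ω| ∂μ := integral_const_mul _ _
    _ ≤ _ := by gcongr; exact integral_abs_le_sqrt_integral_sq hYZ

end ProbabilityTheory

end Blocks

/-! ### Central limit theorem by big blocks and small gaps. -/

section BlockCLT

open scoped Topology

/-- Interchange of limits for uniformly close double sequences. -/
lemma Filter.tendsto_of_tendsto_approx {E : Type*} [PseudoMetricSpace E] {a : ℕ → E}
    {b : ℕ → ℕ → E} {β : ℕ → E} {l : E} {e : ℕ → ℕ → ℝ} {δ : ℕ → ℝ}
    (hb : ∀ M, Tendsto (b M) atTop (𝓝 (β M))) (hβ : Tendsto β atTop (𝓝 l))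
    (he : ∀ M, Tendsto (e M) atTop (𝓝 (δ M))) (hδ : Tendsto δ atTop (𝓝 0))
    (h : ∀ M N, dist (a N) (b M N) ≤ e M N) : Tendsto a atTop (𝓝 l) := by
  rw [Metric.tendsto_nhds]
  intro ε hε
  obtain ⟨M, hM, hM'⟩ := (((Metric.tendsto_nhds.1 hβ) (ε / 3) (by positivity)).and
    (hδ.eventually_lt_const (show 0 < ε / 3 by positivity))).exists
  filter_upwards [(Metric.tendsto_nhds.1 (hb M)) (ε / 3) (by positivity),
    (he M).eventually_lt_const hM'] with N h1 h2
  have := h M N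
  have := dist_triangle4 (a N) (b M N) (β M) l
  linarith

lemma tendsto_natDiv_div (L : ℕ) (hL : 0 < L) :
    Tendsto (fun N : ℕ => ((N / L : ℕ) : ℝ) / N) atTop (𝓝 (1 / L)) := by
  have h1 : Tendsto (fun N : ℕ => (1 : ℝ) / L - 1 / (N : ℝ)) atTop (𝓝 (1 / L)) := by
    simpa using (tendsto_const_nhds (x := (1 : ℝ) / L)).sub tendsto_one_div_atTop_nhds_zero_nat
  refine tendsto_of_tendsto_of_tendsto_of_le_of_le' h1 tendsto_const_nhds ?_ ?_
  · filter_upwards [eventually_gt_atTop 0] with N hN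
    have hN' : (0 : ℝ) < N := by exact_mod_cast hN
    have hL' : (0 : ℝ) < L := by exact_mod_cast hL
    have h : (N : ℝ) ≤ L * (N / L : ℕ) + L := by
      have := Nat.lt_div_mul_add (a := N) hL
      have h' : N ≤ L * (N / L) + L := by rw [mul_comm]; exact this.le
      exact_mod_cast h'
    rw [div_sub_div _ _ hL'.ne' hN'.ne', div_le_div_iff₀ (by positivity) hN']
    nlinarith
  · filter_upwards [eventually_gt_atTop 0] with N hN
    have hN' : (0 : ℝ) < N := by exact_mod_cast hN
    have hL' : (0 : ℝ) < L := by exact_mod_cast hL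
    rw [div_le_div_iff₀ hN' hL', one_mul]
    exact_mod_cast Nat.div_mul_le_self N L

namespace ProbabilityTheory

variable {Ω : Type*} [MeasurableSpace Ω] {μ : Measure Ω} [IsProbabilityMeasure μ]

/-- The central limit theorem along `N / L` summands, normalized by `√N`. -/
lemma tendsto_charFun_sum_natDiv {B : ℕ → Ω → ℝ} {w : ℝ} {L : ℕ} (hL : 0 < L)
    (hB : MemLp (B 0) 2 μ) (hmean : ∫ ω, B 0 ω ∂μ = 0) (hw : ∫ ω, B 0 ω ^ 2 ∂μ = w)
    (hind : iIndepFun B μ) (hid : ∀ q, IdentDistrib (B q) (B 0) μ μ) (u : ℝ) :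
    Tendsto (fun N : ℕ => charFun (μ.map fun ω => (√(N : ℝ))⁻¹ * ∑ q ∈ Finset.range (N / L), B q ω) u)
      atTop (𝓝 (Complex.exp (((-(w / L * u ^ 2 / 2) : ℝ) : ℂ)))) := by
  have hvar : Var[B 0; μ] = w := by
    rw [variance_of_integral_eq_zero hB.aestronglyMeasurable.aemeasurable hmean]
    exact hw
  have hw0 : 0 ≤ w := hvar ▸ variance_nonneg _ _
  have hclt := tendstoInDistribution_inv_sqrt_mul_sum_sub (P' := gaussianReal 0 Var[B 0; μ].toNNReal)
    (Y := id) HasLaw.id hB hind hid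
  simp only [hmean, mul_zero, sub_zero] at hclt
  have hdiv : Tendsto (fun N : ℕ => N / L) atTop atTop := Nat.tendsto_div_const_atTop hL.ne'
  have hclt' : TendstoInDistribution (fun (N : ℕ) ω =>
      (√((N / L : ℕ) : ℝ))⁻¹ * ∑ q ∈ Finset.range (N / L), B q ω) atTop id (fun _ => μ)
      (gaussianReal 0 Var[B 0; μ].toNNReal) :=
    ⟨fun N => hclt.forall_aemeasurable (N / L), hclt.aemeasurable_limit, hclt.tendsto.comp hdiv⟩
  -- The CLT normalizes by the root of the number `N / L` of summands. This deterministic factor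
  -- changes it to `√N` and the variance `w` to `w / L`.
  have hscale : Tendsto (fun N : ℕ => √(((N / L : ℕ) : ℝ) / N)) atTop (𝓝 √(1 / L)) :=
    (tendsto_natDiv_div L hL).sqrt
  have hS := hclt'.continuous_comp_prodMk_of_tendstoInMeasure_const
    (g := fun x : ℝ × ℝ => x.1 * x.2) (by fun_prop)
    (tendstoInMeasure_of_tendsto_ae (μ := μ)
      (f := fun (N : ℕ) (_ : Ω) => √(((N / L : ℕ) : ℝ) / N)) (by fun_prop)
      (ae_of_all _ fun _ => hscale)) (by fun_prop)
  have hlim := ProbabilityMeasure.tendsto_iff_tendsto_charFun.1 hS.tendsto u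
  simp only [ProbabilityMeasure.coe_mk] at hlim
  convert hlim using 2
  · rename_i N
    congr 2
    ext ω
    rcases Nat.eq_zero_or_pos (N / L) with h0 | h0
    · simp [h0]
    · have : (0 : ℝ) < ((N / L : ℕ) : ℝ) := by exact_mod_cast h0
      rw [Real.sqrt_div' _ (Nat.cast_nonneg N)]
      field_simp
  · simp_rw [id, mul_comm _ (√(1 / (L : ℝ)))]
    rw [charFun_map_mul, charFun_gaussianReal, hvar]
    congr 1
    have h1 : √(1 / (L : ℝ)) ^ 2 = 1 / L := Real.sq_sqrt (by positivity)
    rw [Real.coe_toNNReal _ hw0]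
    norm_cast
    rw [mul_pow, h1]
    push_cast
    ring

/-- A central limit theorem for orthogonal sequences whose blocks, when separated by gaps of
length `K`, are independent and identically distributed. -/
theorem tendsto_charFun_of_blocks {D : ℕ → Ω → ℝ} {v : ℝ} (K : ℕ) (hD : ∀ t, MemLp (D t) 2 μ)
    (hmean : ∀ t, ∫ ω, D t ω ∂μ = 0)
    (horth : ∀ s t, ∫ ω, D s ω * D t ω ∂μ = if s = t then v else 0)
    (hind : ∀ M, iIndepFun (fun (q : ℕ) ω => ∑ t ∈ Finset.range M, D (q * (M + K) + t) ω) μ)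
    (hid : ∀ M q, IdentDistrib (fun ω => ∑ t ∈ Finset.range M, D (q * (M + K) + t) ω)
      (fun ω => ∑ t ∈ Finset.range M, D (0 * (M + K) + t) ω) μ μ) (u : ℝ) :
    Tendsto (fun N : ℕ => charFun (μ.map fun ω => (√(N : ℝ))⁻¹ * ∑ t ∈ Finset.range N, D t ω) u)
      atTop (𝓝 (Complex.exp (((-(v * u ^ 2 / 2) : ℝ) : ℂ)))) := by
  have hv : 0 ≤ v := by
    have := horth 0 0
    simp only [if_true] at this
    rw [← this]
    exact integral_nonneg fun ω => mul_self_nonneg _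
  have hB : ∀ M q, MemLp (fun ω => ∑ t ∈ Finset.range M, D (q * (M + K) + t) ω) 2 μ :=
    fun M q => memLp_finsetSum _ fun t _ => hD _
  have hratio : Tendsto (fun M : ℕ => ((M + 1 : ℕ) : ℝ) / ((M + 1 + K : ℕ) : ℝ)) atTop (𝓝 1) := by
    have h := (tendsto_natCast_div_add_atTop (𝕜 := ℝ) (K : ℝ)).comp (tendsto_add_atTop_nat 1)
    refine h.congr fun M => ?_
    simp
  -- Blocks have length `M + 1`, so the period `M + 1 + K` is positive even for `K = 0`. `β M` is
  -- the Gaussian limit of the blocks alone; `e M N` comes from the second moment of the discarded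
  -- terms, whose proportion tends to `K / (M + 1 + K)`.
  refine tendsto_of_tendsto_approx
    (b := fun M N => charFun (μ.map fun ω => (√(N : ℝ))⁻¹ *
      ∑ q ∈ Finset.range (N / (M + 1 + K)), ∑ t ∈ Finset.range (M + 1), D (q * (M + 1 + K) + t) ω) u)
    (β := fun M => Complex.exp (((-(((M + 1 : ℕ) * v) / (M + 1 + K : ℕ) * u ^ 2 / 2) : ℝ) : ℂ)))
    (e := fun M N => |u| * √((1 - ((N / (M + 1 + K) : ℕ) : ℝ) / N * (M + 1 : ℕ)) * v))
    (δ := fun M => |u| * √((1 - 1 / (M + 1 + K : ℕ) * (M + 1 : ℕ)) * v))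
    (fun M => ?_) ?_ (fun M => ?_) ?_ (fun M N => ?_)
  · refine tendsto_charFun_sum_natDiv (by positivity) (hB (M + 1) 0) ?_ ?_ (hind _) (hid _) u
    · rw [integral_finsetSum _ fun t _ => (hD _).integrable (by norm_num)]
      simp [hmean]
    · rw [integral_sq_sum_of_orthogonal (D := fun t => D (0 * (M + 1 + K) + t)) (v := v)
        (fun t => hD _) (fun s t => by rw [horth]; simp), Finset.card_range]
  · refine ((Complex.continuous_exp.comp Complex.continuous_ofReal).tendsto _).comp ?_
    have := (((hratio.mul_const v).mul_const (u ^ 2)).div_const 2).neg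
    rw [one_mul] at this
    refine this.congr fun M => ?_
    ring
  · exact ((((tendsto_natDiv_div _ (by positivity)).mul_const _).const_sub _).mul_const _).sqrt.const_mul _
  · have := (((hratio.const_sub 1).mul_const v).sqrt).const_mul |u|
    rw [sub_self, zero_mul, Real.sqrt_zero, mul_zero] at this
    refine this.congr fun M => ?_
    rw [one_div, div_eq_inv_mul]
  · rw [dist_eq_norm]
    set L := M + 1 + K with hL
    set p := N / L with hp
    refine (norm_charFun_sub_le ((memLp_finsetSum _ fun t _ => hD t).const_mul _)
      ((memLp_finsetSum _ fun q _ => hB (M + 1) q).const_mul _) u).trans ?_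
    gcongr
    rcases Nat.eq_zero_or_pos N with h0 | h0
    · subst h0
      simp [hv]
    have hN : (0 : ℝ) < N := by exact_mod_cast h0
    have hinj : Set.InjOn (fun x : ℕ × ℕ => x.1 * L + x.2)
        (Finset.range p ×ˢ Finset.range (M + 1) : Finset (ℕ × ℕ)) := by
      rintro ⟨a, b⟩ hab ⟨c, d⟩ hcd h
      simp only [Finset.coe_product, Set.mem_prod, Finset.mem_coe, Finset.mem_range] at hab hcd h
      have h1 : (a * L + b) / L = a := by
        rw [mul_comm, Nat.mul_add_div (by omega), Nat.div_eq_of_lt (by omega), add_zero]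
      have h2 : (c * L + d) / L = c := by
        rw [mul_comm, Nat.mul_add_div (by omega), Nat.div_eq_of_lt (by omega), add_zero]
      have hac : a = c := by rw [← h1, ← h2, h]
      subst hac
      simpa using h
    -- The times covered by complete blocks; the complement in `range N` consists of the gaps and
    -- the incomplete last period.
    set G := (Finset.range p ×ˢ Finset.range (M + 1)).image fun x : ℕ × ℕ => x.1 * L + x.2 with hG
    have hGN : G ⊆ Finset.range N := by
      intro t ht
      simp only [hG, Finset.mem_image, Finset.mem_product, Finset.mem_range, Prod.exists] at ht
      obtain ⟨a, b, ⟨ha, hb⟩, rfl⟩ := ht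
      have h1 : (a + 1) * L ≤ p * L := Nat.mul_le_mul_right _ ha
      have h2 : p * L ≤ N := Nat.div_mul_le_self N L
      rw [Finset.mem_range]
      rw [add_mul, one_mul] at h1
      omega
    have hcard : ((Finset.range N \ G).card : ℝ) = N - p * (M + 1 : ℕ) := by
      rw [Finset.card_sdiff_of_subset hGN, Nat.cast_sub (Finset.card_le_card hGN),
        hG, Finset.card_image_of_injOn hinj]
      simp
    have hdiff : ∀ ω, (√(N : ℝ))⁻¹ * ∑ t ∈ Finset.range N, D t ω - (√(N : ℝ))⁻¹ *
        ∑ q ∈ Finset.range p, ∑ t ∈ Finset.range (M + 1), D (q * L + t) ω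
        = (√(N : ℝ))⁻¹ * ∑ t ∈ Finset.range N \ G, D t ω := by
      intro ω
      rw [← Finset.sum_product' (f := fun q t => D (q * L + t) ω),
        ← Finset.sum_image (f := fun t => D t ω) hinj, ← mul_sub, ← Finset.sum_sdiff hGN]
      rw [← hG]
      ring
    refine (integral_congr_ae (ae_of_all _ fun ω => congrArg (· ^ 2) (hdiff ω))).trans_le ?_
    simp only [mul_pow]
    rw [integral_const_mul, integral_sq_sum_of_orthogonal hD horth, hcard, inv_pow,
      Real.sq_sqrt hN.le]
    apply le_of_eq
    field_simp

end ProbabilityTheory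

end BlockCLT

/-! ### Orthonormality and joint Gaussian limit of the lagged products. -/

section LaggedProducts

open scoped Topology

namespace ProbabilityTheory

variable {Ω : Type*} [MeasurableSpace Ω] {μ : Measure Ω}
  {X : ℕ → Ω → ℝ}

/-- The expectation factors when one observation does not appear in the second factor. -/
lemma integral_mul_of_notMem (hX : ∀ n, Measurable (X n)) (hindep : iIndepFun X μ) {s : ℕ}
    {T : Finset ℕ} (hs : s ∉ T) {φ : ℝ → ℝ} (hφ : Measurable φ) {ψ : (T → ℝ) → ℝ}
    (hψ : Measurable ψ) :
    ∫ ω, φ (X s ω) * ψ (fun i => X i ω) ∂μ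
      = (∫ ω, φ (X s ω) ∂μ) * ∫ ω, ψ (fun i => X i ω) ∂μ := by
  have h := hindep.indepFun_finset {s} T (by simpa using hs) hX
  have hφ' : Measurable fun y : ({s} : Finset ℕ) → ℝ => φ (y ⟨s, by simp⟩) := by fun_prop
  exact h.integral_fun_comp_mul_comp (by fun_prop) (by fun_prop) hφ'.aestronglyMeasurable
    hψ.aestronglyMeasurable

/-- Functions of the observations of an i.i.d. sample which are standardized and uncorrelated. -/
structure IsOrthonormalSample {ι : Type*} [DecidableEq ι] (μ : Measure Ω) (X : ℕ → Ω → ℝ)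
    (g : ι → ℝ → ℝ) : Prop where
  measurable_sample : ∀ n, Measurable (X n)
  indep : iIndepFun X μ
  identDistrib : ∀ n, IdentDistrib (X n) (X 0) μ μ
  measurable : ∀ i, Measurable (g i)
  memLp_zero : ∀ i, MemLp (fun ω => g i (X 0 ω)) 2 μ
  mean_zero : ∀ i, ∫ ω, g i (X 0 ω) ∂μ = 0
  cov_zero : ∀ i j, ∫ ω, g i (X 0 ω) * g j (X 0 ω) ∂μ = if i = j then 1 else 0

namespace IsOrthonormalSample

variable {κ : Type*} [DecidableEq κ] {g : κ → ℝ → ℝ}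

lemma memLp (h : IsOrthonormalSample μ X g) (i : κ) (t : ℕ) :
    MemLp (fun ω => g i (X t ω)) 2 μ :=
  ((h.identDistrib t).comp (h.measurable i)).memLp_iff.2 (h.memLp_zero i)

lemma mean (h : IsOrthonormalSample μ X g) (i : κ) (t : ℕ) : ∫ ω, g i (X t ω) ∂μ = 0 :=
  ((h.identDistrib t).comp (h.measurable i)).integral_eq.trans (h.mean_zero i)

lemma integral_mul_same (h : IsOrthonormalSample μ X g) (i j : κ) (t : ℕ) :
    ∫ ω, g i (X t ω) * g j (X t ω) ∂μ = if i = j then 1 else 0 := by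
  rw [← h.cov_zero i j]
  exact ((h.identDistrib t).comp (u := fun x => g i x * g j x)
    ((h.measurable i).mul (h.measurable j))).integral_eq

lemma integral_mul (h : IsOrthonormalSample μ X g) (i j : κ) (s t : ℕ) :
    ∫ ω, g i (X s ω) * g j (X t ω) ∂μ = if s = t ∧ i = j then 1 else 0 := by
  have hi := h.measurable i
  have hj := h.measurable j
  by_cases hst : s = t
  · subst hst
    simp [h.integral_mul_same]
  · rw [integral_mul_of_notMem (T := {t}) (ψ := fun y => g j (y ⟨t, by simp⟩))
      h.measurable_sample h.indep (by simpa using hst) hi (by fun_prop), h.mean]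
    simp [hst]

/-- By independence the squares have an integrable product, so second moments of the factors
suffice. -/
lemma memLp_mul (h : IsOrthonormalSample μ X g) (i j : κ) {s t : ℕ} (hst : s ≠ t) :
    MemLp (fun ω => g i (X s ω) * g j (X t ω)) 2 μ := by
  have hi := h.measurable i
  have hj := h.measurable j
  have hX := h.measurable_sample
  rw [memLp_two_iff_integrable_sq (by fun_prop)]
  simp_rw [mul_pow]
  exact ((h.indep.indepFun hst).comp (φ := fun x => g i x ^ 2) (ψ := fun x => g j x ^ 2)
    (by fun_prop) (by fun_prop)).integrable_mul (h.memLp i s).integrable_sq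
    (h.memLp j t).integrable_sq

/-- The earliest observation `X s` occurs only in `g i (X s)`, which has mean zero and is
independent of the other factors. -/
lemma integral_lagged_mul_of_lt (h : IsOrthonormalSample μ X g) (i j i' j' : κ) {s t k l : ℕ}
    (hk : 0 < k) (hst : s < t) :
    ∫ ω, (g i (X s ω) * g j (X (s + k) ω)) * (g i' (X t ω) * g j' (X (t + l) ω)) ∂μ = 0 := by
  have hm := h.measurable
  have := integral_mul_of_notMem (T := {s + k, t, t + l}) (s := s)
    (ψ := fun y => g j (y ⟨s + k, by simp⟩) * (g i' (y ⟨t, by simp⟩) * g j' (y ⟨t + l, by simp⟩)))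
    h.measurable_sample h.indep (by simp; omega) (hm i) (by fun_prop)
  rw [h.mean, zero_mul] at this
  simpa only [mul_assoc] using this

/-- For equal starting times the expectation splits into a factor at time `s` and one at the later
times `s + k`, `s + l`, each given by orthonormality. -/
lemma integral_lagged_mul (h : IsOrthonormalSample μ X g) (i j i' j' : κ) {s t k l : ℕ}
    (hk : 0 < k) (hl : 0 < l) :
    ∫ ω, (g i (X s ω) * g j (X (s + k) ω)) * (g i' (X t ω) * g j' (X (t + l) ω)) ∂μ
      = if s = t ∧ k = l ∧ i = i' ∧ j = j' then 1 else 0 := by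
  have hm := h.measurable
  rcases lt_trichotomy s t with hst | hst | hst
  · rw [h.integral_lagged_mul_of_lt i j i' j' hk hst, if_neg (by omega)]
  · subst hst
    have := integral_mul_of_notMem (T := {s + k, s + l}) (s := s)
      (φ := fun x => g i x * g i' x)
      (ψ := fun y => g j (y ⟨s + k, by simp⟩) * g j' (y ⟨s + l, by simp⟩))
      h.measurable_sample h.indep (by simp; omega) (by fun_prop) (by fun_prop)
    rw [h.integral_mul_same, h.integral_mul] at this
    simp only [mul_mul_mul_comm, this, add_right_inj]
    by_cases h1 : i = i' <;> by_cases h2 : k = l <;> by_cases h3 : j = j' <;> simp [h1, h2, h3]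
  · rw [if_neg (by omega), ← h.integral_lagged_mul_of_lt i' j' i j (k := l) (l := k) hl hst]
    simp_rw [mul_comm]

variable {m K : ℕ} {g : Fin m → ℝ → ℝ}

/-- The linear combination with coefficients `a` of the lagged products starting at time `t`. -/
def _root_.SerialTest.laggedComb (g : Fin m → ℝ → ℝ) (a : Fin K × Fin m × Fin m → ℝ)
    (x : ℕ → ℝ) (t : ℕ) : ℝ :=
  -- The index `p.1 : Fin K` starts at `0` and encodes the lag `p.1 + 1`.
  ∑ p, a p * (g p.2.1 (x t) * g p.2.2 (x (t + (p.1 + 1))))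

open SerialTest

lemma memLp_laggedComb (h : IsOrthonormalSample μ X g) (a : Fin K × Fin m × Fin m → ℝ) (t : ℕ) :
    MemLp (fun ω => laggedComb g a (X · ω) t) 2 μ :=
  memLp_finsetSum _ fun p _ => (h.memLp_mul _ _ (by omega)).const_mul _

lemma integral_laggedComb [IsProbabilityMeasure μ] (h : IsOrthonormalSample μ X g) (a : Fin K × Fin m × Fin m → ℝ) (t : ℕ) :
    ∫ ω, laggedComb g a (X · ω) t ∂μ = 0 := by
  simp only [laggedComb]
  rw [integral_finsetSum _ fun p _ =>
    ((h.memLp_mul _ _ (by omega)).integrable (by norm_num)).const_mul _]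
  simp [integral_const_mul, h.integral_mul]

lemma integral_laggedComb_mul (h : IsOrthonormalSample μ X g) (a : Fin K × Fin m × Fin m → ℝ)
    (s t : ℕ) :
    ∫ ω, laggedComb g a (X · ω) s * laggedComb g a (X · ω) t ∂μ
      = if s = t then ∑ p, a p ^ 2 else 0 := by
  have hint : ∀ p q : Fin K × Fin m × Fin m, Integrable (fun ω =>
      (a p * (g p.2.1 (X s ω) * g p.2.2 (X (s + (p.1 + 1)) ω))) *
      (a q * (g q.2.1 (X t ω) * g q.2.2 (X (t + (q.1 + 1)) ω)))) μ := fun p q =>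
    ((h.memLp_mul _ _ (by omega)).const_mul _).integrable_mul
      ((h.memLp_mul _ _ (by omega)).const_mul _)
  simp_rw [laggedComb, Finset.sum_mul_sum]
  rw [integral_finsetSum _ fun p _ => integrable_finsetSum _ fun q _ => hint p q]
  simp_rw [integral_finsetSum _ fun q _ => hint _ q, mul_mul_mul_comm (a _), integral_const_mul,
    h.integral_lagged_mul _ _ _ _ (Nat.succ_pos _) (Nat.succ_pos _)]
  by_cases hst : s = t
  · have : ∀ p q : Fin K × Fin m × Fin m,
        ((p.1 : ℕ) + 1 = q.1 + 1 ∧ p.2.1 = q.2.1 ∧ p.2.2 = q.2.2) ↔ p = q := by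
      rintro ⟨p1, p2, p3⟩ ⟨q1, q2, q3⟩
      simp [Fin.ext_iff]
    simp only [hst, true_and, this]
    simp [sq]
  · simp [hst]

/-- A block of `M` terms reads only `M + K` observations, through a function that does not depend on
its position `b`. Blocks starting at multiples of `M + K` therefore read disjoint windows and are
i.i.d. -/
lemma exists_measurable_sum_laggedComb (hg : ∀ i, Measurable (g i))
    (a : Fin K × Fin m × Fin m → ℝ) (M : ℕ) :
    ∃ F : (Fin (M + K) → ℝ) → ℝ, Measurable F ∧ ∀ (x : ℕ → ℝ) (b : ℕ),
      F (fun r => x (b + r)) = ∑ t ∈ Finset.range M, laggedComb g a x (b + t) := by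
  refine ⟨fun y => ∑ t : Fin M, ∑ p : Fin K × Fin m × Fin m,
    a p * (g p.2.1 (y ⟨t, by omega⟩) * g p.2.2 (y ⟨t + (p.1 + 1), by omega⟩)), by fun_prop,
    fun x b => ?_⟩
  simp only [laggedComb, Finset.sum_range, add_assoc]

variable [IsProbabilityMeasure μ]

theorem tendsto_charFun_laggedComb (h : IsOrthonormalSample μ X g)
    (a : Fin K × Fin m × Fin m → ℝ) (u : ℝ) :
    Tendsto (fun N : ℕ => charFun (μ.map fun ω =>
      (√(N : ℝ))⁻¹ * ∑ t ∈ Finset.range N, laggedComb g a (X · ω) t) u)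
      atTop (𝓝 (Complex.exp (((-((∑ p, a p ^ 2) * u ^ 2 / 2) : ℝ) : ℂ)))) := by
  refine tendsto_charFun_of_blocks K (h.memLp_laggedComb a) (h.integral_laggedComb a)
    (h.integral_laggedComb_mul a) (fun M => ?_) (fun M q => ?_) u
  · obtain ⟨F, hF, hFx⟩ := exists_measurable_sum_laggedComb h.measurable a M
    convert (iIndepFun.blocks h.measurable_sample h.indep (M + K)).comp (fun _ => F) fun _ => hF
      using 2 with q
    ext ω
    exact (hFx (X · ω) _).symm
  · obtain ⟨F, hF, hFx⟩ := exists_measurable_sum_laggedComb h.measurable a M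
    simp_rw [← hFx]
    exact (IdentDistrib.tuple h.indep h.identDistrib (a := fun r : Fin (M + K) => q * (M + K) + r)
      (b := fun r : Fin (M + K) => 0 * (M + K) + r) (fun r s hrs => by simpa [Fin.ext_iff] using hrs)
      (fun r s hrs => by simpa [Fin.ext_iff] using hrs)).comp hF

/-- The vector of normalized sums of lagged products is asymptotically standard Gaussian. -/
theorem tendstoInDistribution_laggedProducts (h : IsOrthonormalSample μ X g) :
    TendstoInDistribution (fun (N : ℕ) ω => (WithLp.toLp 2 fun p : Fin K × Fin m × Fin m =>
        (√(N : ℝ))⁻¹ * ∑ t ∈ Finset.range N,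
          g p.2.1 (X t ω) * g p.2.2 (X (t + (p.1 + 1)) ω) : EuclideanSpace ℝ (Fin K × Fin m × Fin m)))
      atTop id (fun _ => μ) (stdGaussian (EuclideanSpace ℝ (Fin K × Fin m × Fin m))) := by
  have hg := h.measurable
  have hX := h.measurable_sample
  have hm : ∀ N : ℕ, Measurable fun ω => (WithLp.toLp 2 fun p : Fin K × Fin m × Fin m =>
        (√(N : ℝ))⁻¹ * ∑ t ∈ Finset.range N, g p.2.1 (X t ω) * g p.2.2 (X (t + (p.1 + 1)) ω) :
        EuclideanSpace ℝ (Fin K × Fin m × Fin m)) := fun N => by fun_prop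
  refine ⟨fun N => (hm N).aemeasurable, by fun_prop, ?_⟩
  refine ProbabilityMeasure.tendsto_iff_tendsto_charFun.2 fun a => ?_
  simp only [ProbabilityMeasure.coe_mk, Measure.map_id, charFun_stdGaussian]
  -- Cramér–Wold: the characteristic function of the vector at `a` is that of its inner product with
  -- `a` at `1`.
  convert h.tendsto_charFun_laggedComb (fun p => a p) 1 using 2
  · rename_i N
    rw [charFun_apply, charFun_apply, integral_map (hm N).aemeasurable (by fun_prop),
      integral_map (by unfold laggedComb; fun_prop) (by fun_prop)]
    congr 1
    ext ω
    congr 3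
    simp only [PiLp.inner_apply, laggedComb, RCLike.inner_apply, conj_trivial, one_mul]
    rw [Finset.sum_comm, Finset.mul_sum]
    refine Finset.sum_congr rfl fun p _ => ?_
    rw [← Finset.mul_sum]
    ring
  · rw [← Complex.ofReal_pow, EuclideanSpace.real_norm_sq_eq]
    congr 1
    push_cast
    ring

end IsOrthonormalSample

end ProbabilityTheory

end LaggedProducts

/-! ### Algebra of the statistic: affine invariance, weights and remainder. -/

section LjungBox

open scoped Topology

namespace SerialTest

lemma empMean_affine {x : ℕ → ℝ} {N : ℕ} (hN : 0 < N) {f g : ℝ → ℝ} {σ b : ℝ}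
    (h : ∀ y, f y = σ * g y + b) : empMean x N f = σ * empMean x N g + b := by
  have : (N : ℝ) ≠ 0 := by exact_mod_cast hN.ne'
  simp only [empMean, h, Finset.sum_add_distrib, ← Finset.mul_sum, Finset.sum_const,
    Finset.card_range, nsmul_eq_mul]
  field_simp

lemma empStd_affine {x : ℕ → ℝ} {N : ℕ} (hN : 0 < N) {f g : ℝ → ℝ} {σ b : ℝ} (hσ : 0 ≤ σ)
    (h : ∀ y, f y = σ * g y + b) : empStd x N f = σ * empStd x N g := by
  have : empVar x N f = σ ^ 2 * empVar x N g := by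
    simp only [empVar, empMean_affine hN h, h, add_sub_add_right_eq_sub, ← mul_sub, mul_pow,
      ← Finset.mul_sum]
    ring
  rw [empStd, this, Real.sqrt_mul (sq_nonneg _), Real.sqrt_sq hσ, empStd]

lemma empCrossCov_affine {x : ℕ → ℝ} {N : ℕ} (hN : 0 < N) (k : ℕ) {f f' g g' : ℝ → ℝ}
    {σ σ' b b' : ℝ} (h : ∀ y, f y = σ * g y + b) (h' : ∀ y, f' y = σ' * g' y + b') :
    empCrossCov x N k f f' = σ * σ' * empCrossCov x N k g g' := by
  simp only [empCrossCov, empMean_affine hN h, empMean_affine hN h', h, h',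
    add_sub_add_right_eq_sub, ← mul_sub, mul_mul_mul_comm, ← Finset.mul_sum]
  ring

/-- The Ljung–Box statistic is invariant under increasing affine transformations. -/
lemma ljungBox_affine {m : ℕ} {f g : Fin m → ℝ → ℝ} {σ b : Fin m → ℝ} (hσ : ∀ i, 0 < σ i)
    (h : ∀ i y, f i y = σ i * g i y + b i) (K : ℕ) (c : ℝ) (x : ℕ → ℝ) (N : ℕ) :
    ljungBox f K c x N = ljungBox g K c x N := by
  rcases Nat.eq_zero_or_pos N with rfl | hN
  · simp [ljungBox]
  have : ∀ k, corrVector f x N k = corrVector g x N k := fun k => by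
    unfold corrVector
    congr 1
    ext ⟨i, j⟩
    simp only [empCrossCorr, empCrossCov_affine hN k (h i) (h j),
      empStd_affine hN (hσ i).le (h i), empStd_affine hN (hσ j).le (h j)]
    -- Only `σ i * σ j` is cancelled, so a vanishing empirical deviation does no harm.
    rw [mul_mul_mul_comm, mul_div_mul_left _ _ (mul_pos (hσ i) (hσ j)).ne']
  simp only [ljungBox, this]

lemma empVar_nonneg (x : ℕ → ℝ) (N : ℕ) (f : ℝ → ℝ) : 0 ≤ empVar x N f :=
  mul_nonneg (by positivity) (Finset.sum_nonneg fun _ _ => sq_nonneg _)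

lemma empVar_eq {x : ℕ → ℝ} {N : ℕ} (hN : 0 < N) (f : ℝ → ℝ) :
    empVar x N f = (∑ i ∈ Finset.range N, f (x i) ^ 2) / N
      - ((∑ i ∈ Finset.range N, f (x i)) / N) ^ 2 := by
  have : (N : ℝ) ≠ 0 := by exact_mod_cast hN.ne'
  simp only [empVar, empMean, sub_sq, Finset.sum_add_distrib, Finset.sum_sub_distrib,
    ← Finset.sum_mul, ← Finset.mul_sum, Finset.sum_const, Finset.card_range, nsmul_eq_mul]
  field_simp
  ring

/-- The normalized sum of lagged products of empirically centered observations. -/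
noncomputable def centeredLagSum (x : ℕ → ℝ) (N k : ℕ) (f g : ℝ → ℝ) : ℝ :=
  (√(N : ℝ))⁻¹ * ∑ i ∈ Finset.range (N - k),
    (f (x i) - empMean x N f) * (g (x (i + k)) - empMean x N g)

/-- The weight of a squared centered lag sum in the Ljung–Box statistic. -/
noncomputable def lagWeight (c : ℝ) (x : ℕ → ℝ) (N k : ℕ) (f g : ℝ → ℝ) : ℝ :=
  -- One factor `N - k` comes from the statistic and two from the squared cross-covariance; the
  -- extra `N` offsets the `1 / N` in the squared `centeredLagSum`.
  (N : ℝ) ^ 2 * (N + c) / (N - k) ^ 3 * (empVar x N f * empVar x N g)⁻¹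

/-- Separates the asymptotically Gaussian part from weights tending to `1`, as Slutsky requires. It
holds for every `N`, since the lag sum is empty once the lag reaches `N`. -/
lemma ljungBox_eq {m : ℕ} (f : Fin m → ℝ → ℝ) (K : ℕ) (c : ℝ) (x : ℕ → ℝ) (N : ℕ) :
    ljungBox f K c x N = ∑ p : Fin K × Fin m × Fin m,
      lagWeight c x N (p.1 + 1) (f p.2.1) (f p.2.2) *
        centeredLagSum x N (p.1 + 1) (f p.2.1) (f p.2.2) ^ 2 := by
  have hIcc : ∀ F : ℕ → ℝ, ∑ k ∈ Finset.Icc 1 K, F k = ∑ k : Fin K, F (k + 1) := fun F => by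
    rw [← Finset.sum_range fun k => F (k + 1)]
    induction K with
    | zero => simp
    | succ K ih => rw [Finset.sum_Icc_succ_top (by omega), Finset.sum_range_succ, ih]
  rw [ljungBox, hIcc, Fintype.sum_prod_type, Finset.mul_sum]
  refine Finset.sum_congr rfl fun k _ => ?_
  rw [EuclideanSpace.real_norm_sq_eq, Finset.sum_div, Finset.mul_sum]
  refine Finset.sum_congr rfl fun p _ => ?_
  simp only [corrVector, empCrossCorr, empCrossCov, lagWeight, centeredLagSum, empStd, div_pow,
    mul_pow, inv_pow, Real.sq_sqrt (empVar_nonneg _ _ _), Real.sq_sqrt (Nat.cast_nonneg N)]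
  rcases Nat.eq_zero_or_pos N with rfl | hN
  · simp
  · have : (N : ℝ) ≠ 0 := by exact_mod_cast hN.ne'
    push_cast
    field_simp

/-- A bound for the effect of centering and truncation on a sum of lagged products. -/
noncomputable def lagRemainder (y z : ℕ → ℝ) (N k : ℕ) : ℝ :=
  -- The first sum controls the at most `k` truncated products, the second line the three centering
  -- corrections, all by `|ab| ≤ (a² + b²) / 2`.
  (∑ t ∈ Finset.Ico (N - k) N, (y t ^ 2 + z (t + k) ^ 2)) / 2 +
    (2 * (∑ t ∈ Finset.range N, y t) ^ 2 + 2 * (∑ t ∈ Finset.range N, z t) ^ 2 +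
      (∑ t ∈ Finset.range (N - k), y t) ^ 2 + (∑ t ∈ Finset.range (N - k), z (t + k)) ^ 2) / (2 * N)

lemma abs_centeredLagSum_sub_le (x : ℕ → ℝ) (N k : ℕ) (f g : ℝ → ℝ) :
    |centeredLagSum x N k f g
      - (√(N : ℝ))⁻¹ * ∑ t ∈ Finset.range N, f (x t) * g (x (t + k))|
      ≤ (√(N : ℝ))⁻¹ * lagRemainder (fun t => f (x t)) (fun t => g (x t)) N k := by
  rcases Nat.eq_zero_or_pos N with rfl | hN
  · simp [centeredLagSum]
  have hN' : (0 : ℝ) < N := by exact_mod_cast hN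
  rw [centeredLagSum, ← mul_sub, abs_mul, abs_of_nonneg (by positivity : 0 ≤ (√(N : ℝ))⁻¹)]
  refine mul_le_mul_of_nonneg_left ?_ (by positivity)
  rw [← Finset.sum_range_add_sum_Ico _ (Nat.sub_le N k)]
  set A := ∑ t ∈ Finset.range (N - k), f (x t) with hA
  set B := ∑ t ∈ Finset.range (N - k), g (x (t + k)) with hB
  set S := ∑ t ∈ Finset.range N, f (x t) with hS
  set S' := ∑ t ∈ Finset.range N, g (x t) with hS'
  have hexp : ∑ i ∈ Finset.range (N - k),
      (f (x i) - empMean x N f) * (g (x (i + k)) - empMean x N g)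
      = ∑ i ∈ Finset.range (N - k), f (x i) * g (x (i + k))
        - S' * A / N - S * B / N + (N - k : ℕ) * (S * S') / N ^ 2 := by
    simp only [sub_mul, mul_sub, Finset.sum_sub_distrib, ← Finset.sum_mul, ← Finset.mul_sum,
      Finset.sum_const, Finset.card_range, nsmul_eq_mul, empMean, ← hA, ← hB, ← hS, ← hS']
    field_simp
    ring
  have hprod : ∀ a b : ℝ, |a * b| ≤ (a ^ 2 + b ^ 2) / 2 := fun a b => by
    rw [abs_le]; constructor <;> nlinarith [sq_nonneg (a + b), sq_nonneg (a - b)]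
  have h1 : |∑ t ∈ Finset.Ico (N - k) N, f (x t) * g (x (t + k))|
      ≤ (∑ t ∈ Finset.Ico (N - k) N, (f (x t) ^ 2 + g (x (t + k)) ^ 2)) / 2 := by
    rw [Finset.sum_div]
    exact (Finset.abs_sum_le_sum_abs _ _).trans (Finset.sum_le_sum fun t _ => hprod _ _)
  have h2 : |S' * A / N| ≤ (S' ^ 2 + A ^ 2) / (2 * N) := by
    rw [abs_div, abs_of_pos hN', ← div_div]
    gcongr
    exact hprod _ _
  have h3 : |S * B / N| ≤ (S ^ 2 + B ^ 2) / (2 * N) := by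
    rw [abs_div, abs_of_pos hN', ← div_div]
    gcongr
    exact hprod _ _
  have h4 : |(N - k : ℕ) * (S * S') / N ^ 2| ≤ (S ^ 2 + S' ^ 2) / (2 * N) := by
    rw [abs_div, abs_mul, Nat.abs_cast, abs_of_pos (by positivity : (0 : ℝ) < N ^ 2)]
    have hk : ((N - k : ℕ) : ℝ) ≤ N := by exact_mod_cast Nat.sub_le N k
    calc ((N - k : ℕ) : ℝ) * |S * S'| / N ^ 2 ≤ N * ((S ^ 2 + S' ^ 2) / 2) / N ^ 2 := by
          gcongr
          exact hprod _ _
      _ = _ := by field_simp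
  have hsum : lagRemainder (fun t => f (x t)) (fun t => g (x t)) N k
      = (∑ t ∈ Finset.Ico (N - k) N, (f (x t) ^ 2 + g (x (t + k)) ^ 2)) / 2
        + (S' ^ 2 + A ^ 2) / (2 * N) + (S ^ 2 + B ^ 2) / (2 * N)
        + (S ^ 2 + S' ^ 2) / (2 * N) := by
    simp only [lagRemainder, ← hA, ← hB, ← hS, ← hS']
    ring
  rw [hexp, hsum]
  rw [abs_le] at *
  constructor <;> linarith [h1.1, h1.2, h2.1, h2.2, h3.1, h3.2, h4.1, h4.2]

/-- The law of the squared norm of a standard Gaussian vector is a chi-squared distribution. -/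
lemma map_sum_sq_stdGaussian {ι : Type*} [Fintype ι] {n : ℕ} (hn : Fintype.card ι = n) :
    (stdGaussian (EuclideanSpace ℝ ι)).map (fun z => ∑ p, z p ^ 2) = chiSquared n := by
  have e : Fin n ≃ ι := (Fintype.equivFinOfCardEq hn).symm
  rw [← map_pi_eq_stdGaussian, Measure.map_map (by fun_prop) (by fun_prop), chiSquared,
    ← (measurePreserving_piCongrLeft (fun _ : ι => gaussianReal 0 1) e).map_eq,
    Measure.map_map (by fun_prop) (by fun_prop)]
  congr 1
  ext z
  simp only [Function.comp_apply]
  rw [← e.sum_comp]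
  refine Finset.sum_congr rfl fun i _ => ?_
  rw [MeasurableEquiv.piCongrLeft_apply_apply]

end SerialTest

/-- A sequence dominated by a null sequence times an `L¹`-bounded one tends to `0` in measure. -/
lemma MeasureTheory.tendstoInMeasure_zero_of_norm_le {Ω E : Type*} [MeasurableSpace Ω]
    {μ : Measure Ω} [NormedAddCommGroup E] {V : ℕ → Ω → E} {Q : ℕ → Ω → ℝ} {a : ℕ → ℝ} {C : ℝ}
    (hV : ∀ N, AEStronglyMeasurable (V N) μ) (ha : Tendsto a atTop (𝓝 0)) (ha0 : ∀ N, 0 ≤ a N)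
    (hQ : ∀ N, Integrable (Q N) μ) (hC : ∀ N, ∫ ω, Q N ω ∂μ ≤ C)
    (h : ∀ N ω, ‖V N ω‖ ≤ a N * Q N ω) : TendstoInMeasure μ V atTop 0 := by
  refine tendstoInMeasure_of_tendsto_eLpNorm one_ne_zero hV aestronglyMeasurable_zero ?_
  have hlim : Tendsto (fun N => ENNReal.ofReal (a N * C)) atTop (𝓝 0) := by
    simpa using ENNReal.tendsto_ofReal (ha.mul_const C)
  refine tendsto_of_tendsto_of_tendsto_of_le_of_le tendsto_const_nhds hlim (fun _ => zero_le)
    fun N => ?_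
  rw [sub_zero, eLpNorm_one_eq_lintegral_enorm]
  calc ∫⁻ ω, ‖V N ω‖ₑ ∂μ ≤ ∫⁻ ω, ENNReal.ofReal (a N * Q N ω) ∂μ := by
        gcongr with ω
        rw [← ofReal_norm]
        exact ENNReal.ofReal_le_ofReal (h N ω)
    _ = ENNReal.ofReal (∫ ω, a N * Q N ω ∂μ) :=
        (ofReal_integral_eq_lintegral_ofReal ((hQ N).const_mul _)
          (ae_of_all _ fun ω => (norm_nonneg _).trans (h N ω))).symm
    _ ≤ ENNReal.ofReal (a N * C) := by
        rw [integral_const_mul]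
        exact ENNReal.ofReal_le_ofReal (mul_le_mul_of_nonneg_left (hC N) (ha0 N))

end LjungBox

/-! ### Passage to the limit: negligible remainder, weights and Slutsky. -/

section Limit

open scoped Topology
open SerialTest

namespace ProbabilityTheory.IsOrthonormalSample

variable {Ω : Type*} [MeasurableSpace Ω] {μ : Measure Ω}
  {X : ℕ → Ω → ℝ} {m K : ℕ} {g : Fin m → ℝ → ℝ}

lemma integral_sq_sum (h : IsOrthonormalSample μ X g) (i : Fin m) (k : ℕ) (J : Finset ℕ) :
    ∫ ω, (∑ t ∈ J, g i (X (t + k) ω)) ^ 2 ∂μ = J.card := by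
  rw [integral_sq_sum_of_orthogonal (D := fun t ω => g i (X (t + k) ω)) (v := 1)
    (fun t => h.memLp i _) fun s t => by rw [h.integral_mul]; simp, mul_one]

lemma integrable_sq_sum (h : IsOrthonormalSample μ X g) (i : Fin m) (k : ℕ) (J : Finset ℕ) :
    Integrable (fun ω => (∑ t ∈ J, g i (X (t + k) ω)) ^ 2) μ :=
  (memLp_finsetSum _ fun _ _ => h.memLp i _).integrable_sq

lemma measurable_centeredLagSum (h : IsOrthonormalSample μ X g) (N k : ℕ) (i j : Fin m) :
    Measurable fun ω => centeredLagSum (X · ω) N k (g i) (g j) := by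
  have := h.measurable
  have := h.measurable_sample
  unfold centeredLagSum empMean
  fun_prop

lemma measurable_lagWeight (h : IsOrthonormalSample μ X g) (c : ℝ) (N k : ℕ) (i j : Fin m) :
    Measurable fun ω => lagWeight c (X · ω) N k (g i) (g j) := by
  have := h.measurable
  have := h.measurable_sample
  unfold lagWeight empVar empMean
  fun_prop

lemma integrable_lagRemainder (h : IsOrthonormalSample μ X g) (i j : Fin m) (N k : ℕ) :
    Integrable (fun ω => lagRemainder (fun t => g i (X t ω)) (fun t => g j (X t ω)) N k) μ := by
  unfold lagRemainder
  refine Integrable.add ((integrable_finsetSum _ fun t _ =>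
    (h.memLp i t).integrable_sq.add (h.memLp j _).integrable_sq).div_const _) ?_
  exact (((((h.integrable_sq_sum i 0 _).const_mul 2).add
    ((h.integrable_sq_sum j 0 _).const_mul 2)).add (h.integrable_sq_sum i 0 _)).add
    (h.integrable_sq_sum j k _)).div_const _

/-- A squared sum of `n` orthonormal terms has mean `n ≤ N`, so the centering part is at most `6N /
(2N) = 3`; the truncated terms contribute at most `2k / 2`. -/
lemma integral_lagRemainder_le (h : IsOrthonormalSample μ X g) (i j : Fin m) (N k : ℕ) :
    ∫ ω, lagRemainder (fun t => g i (X t ω)) (fun t => g j (X t ω)) N k ∂μ ≤ k + 3 := by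
  have h1 : ∀ t ∈ Finset.Ico (N - k) N,
      Integrable (fun ω => g i (X t ω) ^ 2 + g j (X (t + k) ω) ^ 2) μ := fun t _ =>
    (h.memLp i t).integrable_sq.add (h.memLp j _).integrable_sq
  have hone : ∀ (i : Fin m) t, ∫ ω, g i (X t ω) ^ 2 ∂μ = 1 := fun i t => by
    simpa [sq] using h.integral_mul i i t t
  have hsplit : ∀ {A B C D E : Ω → ℝ} (r : ℝ), Integrable A μ → Integrable B μ → Integrable C μ →
      Integrable D μ → Integrable E μ →
      ∫ ω, A ω / 2 + (2 * B ω + 2 * C ω + D ω + E ω) / r ∂μ = (∫ ω, A ω ∂μ) / 2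
        + (2 * ∫ ω, B ω ∂μ + 2 * ∫ ω, C ω ∂μ + ∫ ω, D ω ∂μ + ∫ ω, E ω ∂μ) / r := by
    intro A B C D E r hA hB hC hD hE
    have hBC : Integrable (fun ω => 2 * B ω + 2 * C ω) μ := (hB.const_mul 2).add (hC.const_mul 2)
    have hBCD : Integrable (fun ω => 2 * B ω + 2 * C ω + D ω) μ := hBC.add hD
    have hBCDE : Integrable (fun ω => 2 * B ω + 2 * C ω + D ω + E ω) μ := hBCD.add hE
    rw [integral_add (hA.div_const 2) (hBCDE.div_const r), integral_div, integral_div,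
      integral_add hBCD hE, integral_add hBC hD, integral_add (hB.const_mul 2) (hC.const_mul 2),
      integral_const_mul, integral_const_mul]
  have hi := h.integrable_sq_sum i 0
  have hj := h.integrable_sq_sum j 0
  have vi := h.integral_sq_sum i 0
  have vj := h.integral_sq_sum j 0
  simp only [add_zero] at hi vi hj vj
  simp only [lagRemainder]
  rw [hsplit _ (integrable_finsetSum _ h1) (hi _) (hj _) (hi _) (h.integrable_sq_sum j k _),
    integral_finsetSum _ h1, vi, vi, vj, h.integral_sq_sum]
  have h2 : ∀ t, ∫ ω, g i (X t ω) ^ 2 + g j (X (t + k) ω) ^ 2 ∂μ = 2 := fun t => by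
    rw [integral_add (h.memLp i t).integrable_sq (h.memLp j _).integrable_sq, hone, hone]
    norm_num
  simp only [h2, Finset.sum_const, Nat.card_Ico, Finset.card_range, nsmul_eq_mul]
  have hk : ((N - (N - k) : ℕ) : ℝ) ≤ k := by exact_mod_cast (by omega : N - (N - k) ≤ k)
  have hN : ((N - k : ℕ) : ℝ) ≤ N := by exact_mod_cast Nat.sub_le N k
  refine add_le_add (by linarith) (div_le_of_le_mul₀ (by positivity) (by norm_num) (by linarith))

variable [IsProbabilityMeasure μ]

/-- The vector of centered lag sums is asymptotically standard Gaussian. -/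
theorem tendstoInDistribution_centeredLagSum (h : IsOrthonormalSample μ X g) :
    TendstoInDistribution (fun (N : ℕ) ω => (WithLp.toLp 2 fun p : Fin K × Fin m × Fin m =>
        centeredLagSum (X · ω) N (p.1 + 1) (g p.2.1) (g p.2.2) :
        EuclideanSpace ℝ (Fin K × Fin m × Fin m)))
      atTop id (fun _ => μ) (stdGaussian (EuclideanSpace ℝ (Fin K × Fin m × Fin m))) := by
  have hm : ∀ N : ℕ, Measurable fun ω => (WithLp.toLp 2 fun p : Fin K × Fin m × Fin m =>
        centeredLagSum (X · ω) N (p.1 + 1) (g p.2.1) (g p.2.2) :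
        EuclideanSpace ℝ (Fin K × Fin m × Fin m)) := fun N =>
    (WithLp.measurable_toLp 2 _).comp
      (measurable_pi_lambda _ fun p => h.measurable_centeredLagSum _ _ _ _)
  have hg := h.measurable
  have hX := h.measurable_sample
  refine tendstoInDistribution_of_tendstoInMeasure_sub _ _
    h.tendstoInDistribution_laggedProducts ?_ (fun N => (hm N).aemeasurable)
  refine tendstoInMeasure_zero_of_norm_le (a := fun N => (√(N : ℝ))⁻¹)
    (Q := fun N ω => ∑ p : Fin K × Fin m × Fin m,
      lagRemainder (fun t => g p.2.1 (X t ω)) (fun t => g p.2.2 (X t ω)) N (p.1 + 1))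
    (C := ∑ p : Fin K × Fin m × Fin m, (((p.1 : ℕ) + 1 : ℕ) + 3 : ℝ)) (fun N => ?_)
    (tendsto_inv_atTop_zero.comp (Real.tendsto_sqrt_atTop.comp tendsto_natCast_atTop_atTop))
    (fun N => by positivity)
    (fun N => integrable_finsetSum _ fun p _ => h.integrable_lagRemainder _ _ _ _)
    (fun N => ?_) (fun N ω => ?_)
  · exact ((hm N).sub (by fun_prop)).aestronglyMeasurable
  · rw [integral_finsetSum _ fun p _ => h.integrable_lagRemainder _ _ _ _]
    exact Finset.sum_le_sum fun p _ => h.integral_lagRemainder_le _ _ _ _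
  · rw [Finset.mul_sum, EuclideanSpace.norm_eq]
    refine (Real.sqrt_le_sqrt
      (Finset.sum_sq_le_sq_sum_of_nonneg fun p _ => norm_nonneg _)).trans ?_
    rw [Real.sqrt_sq (Finset.sum_nonneg fun p _ => norm_nonneg _)]
    exact Finset.sum_le_sum fun p _ =>
      abs_centeredLagSum_sub_le (X · ω) N (p.1 + 1) (g p.2.1) (g p.2.2)

/-- The empirical variances of standardized functions converge to `1`. -/
lemma ae_tendsto_empVar (h : IsOrthonormalSample μ X g) (i : Fin m) :
    ∀ᵐ ω ∂μ, Tendsto (fun N => empVar (X · ω) N (g i)) atTop (𝓝 1) := by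
  have hpair : ∀ φ : ℝ → ℝ, Measurable φ →
      Pairwise (Function.onFun (IndepFun · · μ) fun n ω => φ (X n ω)) := fun φ hφ s t hst =>
    (h.indep.indepFun hst).comp hφ hφ
  have h1 := strong_law_ae_real (fun n ω => g i (X n ω)) ((h.memLp_zero i).integrable (by norm_num))
    (hpair _ (h.measurable i)) fun n => (h.identDistrib n).comp (h.measurable i)
  have h2 := strong_law_ae_real (fun n ω => g i (X n ω) ^ 2) (h.memLp_zero i).integrable_sq
    (hpair (fun x => g i x ^ 2) ((h.measurable i).pow_const 2))
    fun n => (h.identDistrib n).comp (u := fun x => g i x ^ 2) ((h.measurable i).pow_const 2)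
  have hone : ∫ ω, g i (X 0 ω) ^ 2 ∂μ = 1 := by simpa [sq] using h.cov_zero i i
  filter_upwards [h1, h2] with ω hω1 hω2
  rw [h.mean_zero] at hω1
  rw [hone] at hω2
  have := hω2.sub (hω1.pow 2)
  norm_num at this
  refine this.congr' ?_
  filter_upwards [eventually_gt_atTop 0] with N hN
  rw [empVar_eq hN]

lemma _root_.SerialTest.tendsto_lagWeight_coeff (c : ℝ) (k : ℕ) :
    Tendsto (fun N : ℕ => (N : ℝ) ^ 2 * (N + c) / (N - k) ^ 3) atTop (𝓝 1) := by
  have hinv := tendsto_one_div_atTop_nhds_zero_nat (𝕜 := ℝ)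
  have h : Tendsto (fun N : ℕ => (1 + c * (1 / (N : ℝ))) / (1 - k * (1 / (N : ℝ))) ^ 3) atTop
      (𝓝 ((1 + c * 0) / (1 - k * 0) ^ 3)) :=
    ((hinv.const_mul c).const_add 1).div (((hinv.const_mul (k : ℝ)).const_sub 1).pow 3) (by simp)
  norm_num at h
  refine h.congr' ?_
  filter_upwards [eventually_gt_atTop k] with N hN
  have h0 : (N : ℝ) ≠ 0 := by exact_mod_cast (by omega : N ≠ 0)
  have h1 : (N : ℝ) - k ≠ 0 := sub_ne_zero.2 (by exact_mod_cast hN.ne')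
  have h2 : 1 - (k : ℝ) * (N : ℝ)⁻¹ ≠ 0 := by
    rw [show 1 - (k : ℝ) * (N : ℝ)⁻¹ = (N - k) / N by field_simp]
    exact div_ne_zero h1 h0
  field_simp

lemma ae_tendsto_lagWeight (h : IsOrthonormalSample μ X g) (c : ℝ) (k : ℕ) (i j : Fin m) :
    ∀ᵐ ω ∂μ, Tendsto (fun N => lagWeight c (X · ω) N k (g i) (g j)) atTop (𝓝 1) := by
  filter_upwards [h.ae_tendsto_empVar i, h.ae_tendsto_empVar j] with ω hi hj
  simpa [lagWeight, mul_comm] using (tendsto_lagWeight_coeff c k).mul ((hi.mul hj).inv₀ (by norm_num))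

/-- Convergence of the Ljung–Box statistic for standardized functions. -/
theorem tendstoInDistribution_ljungBox (h : IsOrthonormalSample μ X g) (K : ℕ) (c : ℝ) :
    TendstoInDistribution (fun (N : ℕ) ω => ljungBox g K c (X · ω) N) atTop (id : ℝ → ℝ)
      (fun _ => μ) (chiSquared (m ^ 2 * K)) := by
  have hm := fun N k i j => h.measurable_lagWeight c N k i j
  have hweight : TendstoInMeasure μ (fun (N : ℕ) ω (p : Fin K × Fin m × Fin m) =>
      lagWeight c (X · ω) N (p.1 + 1) (g p.2.1) (g p.2.2)) atTop fun _ _ => 1 := by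
    refine tendstoInMeasure_of_tendsto_ae (fun N =>
      (measurable_pi_lambda _ fun p => hm _ _ _ _).aestronglyMeasurable) ?_
    filter_upwards [ae_all_iff.2 fun p : Fin K × Fin m × Fin m =>
      h.ae_tendsto_lagWeight c (p.1 + 1) p.2.1 p.2.2] with ω hω
    exact tendsto_pi_nhds.2 hω
  -- Slutsky for the pair of Gaussian vector and weights, under the continuous map `(z, w) ↦ ∑ w_p
  -- z_p²`.
  have hS := (h.tendstoInDistribution_centeredLagSum (K := K)
    ).continuous_comp_prodMk_of_tendstoInMeasure_const
    (g := fun z : EuclideanSpace ℝ (Fin K × Fin m × Fin m) × (Fin K × Fin m × Fin m → ℝ) =>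
      ∑ p, z.2 p * z.1 p ^ 2) (by fun_prop) hweight
    (fun N => (measurable_pi_lambda _ fun p => hm _ _ _ _).aemeasurable)
  simp only [← ljungBox_eq, one_mul] at hS
  refine ⟨hS.forall_aemeasurable, aemeasurable_id, ?_⟩
  convert hS.tendsto using 1
  refine congrArg 𝓝 (Subtype.ext ?_)
  simp only [Measure.map_id, id]
  refine (map_sum_sq_stdGaussian ?_).symm
  simp only [Fintype.card_prod, Fintype.card_fin]
  ring

end ProbabilityTheory.IsOrthonormalSample

/-- Standardizing pairwise uncorrelated functions of an i.i.d. sample. -/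
lemma ProbabilityTheory.isOrthonormalSample_standardize {Ω ι : Type*} [MeasurableSpace Ω]
    [DecidableEq ι] {μ : Measure Ω} [IsProbabilityMeasure μ] {X : ℕ → Ω → ℝ}
    (hX : ∀ n, Measurable (X n)) (hindep : iIndepFun X μ)
    (hident : ∀ n, IdentDistrib (X n) (X 0) μ μ) {f : ι → ℝ → ℝ} (hf : ∀ i, Measurable (f i))
    (hL2 : ∀ i, MemLp (fun ω => f i (X 0 ω)) 2 μ)
    (hvar : ∀ i, 0 < Var[fun ω => f i (X 0 ω); μ])
    (hcov : ∀ i j, i ≠ j → cov[fun ω => f i (X 0 ω), fun ω => f j (X 0 ω); μ] = 0) :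
    IsOrthonormalSample μ X fun i y =>
      (f i y - ∫ ω, f i (X 0 ω) ∂μ) / √Var[fun ω => f i (X 0 ω); μ] where
  measurable_sample := hX
  indep := hindep
  identDistrib := hident
  measurable i := ((hf i).sub_const _).div_const _
  memLp_zero i := by
    simp only [div_eq_mul_inv]
    exact ((hL2 i).sub (memLp_const _)).mul_const _
  mean_zero i := by
    rw [integral_div, integral_sub ((hL2 i).integrable (by norm_num)) (integrable_const _)]
    simp
  cov_zero i j := by
    have hcov' : ∫ ω, (f i (X 0 ω) - ∫ ω, f i (X 0 ω) ∂μ) * (f j (X 0 ω) - ∫ ω, f j (X 0 ω) ∂μ) ∂μ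
        = cov[fun ω => f i (X 0 ω), fun ω => f j (X 0 ω); μ] := rfl
    simp_rw [div_mul_div_comm]
    rw [integral_div, hcov']
    split_ifs with hij
    · subst hij
      rw [covariance_self (X := fun ω => f i (X 0 ω)) ((hf i).comp (hX 0)).aemeasurable, Real.mul_self_sqrt (hvar i).le,
        div_self (hvar i).ne']
    · rw [hcov i j hij, zero_div]

end Limit

theorem corollary7 {Ω : Type*} [MeasurableSpace Ω] (μ : Measure Ω) [IsProbabilityMeasure μ]
    (X : ℕ → Ω → ℝ) (hX : ∀ n, Measurable (X n))
    (hindep : iIndepFun X μ) (hident : ∀ n, IdentDistrib (X n) (X 0) μ μ)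
    (m K : ℕ) (f : Fin m → ℝ → ℝ) (hf : ∀ i, Measurable (f i))
    (hmom : ∀ i, Integrable (fun ω => f i (X 0 ω) ^ 4) μ)
    (hvar : ∀ i, 0 < Var[fun ω => f i (X 0 ω); μ])
    (hcov : ∀ i j, i ≠ j → cov[fun ω => f i (X 0 ω), fun ω => f j (X 0 ω); μ] = 0)
    (c : ℝ) (hc : 0 < c) :
    TendstoInDistribution
      (fun (N : ℕ) (ω : Ω) => SerialTest.ljungBox f K c (fun n => X n ω) N)
      atTop (id : ℝ → ℝ) (fun _ => μ) (SerialTest.chiSquared (m ^ 2 * K)) := by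
  have hL2 : ∀ i, MemLp (fun ω => f i (X 0 ω)) 2 μ := fun i => by
    have hm : Measurable fun ω => f i (X 0 ω) := (hf i).comp (hX 0)
    rw [memLp_two_iff_integrable_sq hm.aestronglyMeasurable]
    refine ((integrable_const 1).add (hmom i)).mono' (hm.pow_const 2).aestronglyMeasurable
      (ae_of_all _ fun ω => ?_)
    rw [Real.norm_of_nonneg (sq_nonneg _), Pi.add_apply]
    -- The domination is `y² ≤ 1 + y⁴`.
    nlinarith [sq_nonneg (f i (X 0 ω) ^ 2 - 1), sq_nonneg (f i (X 0 ω))]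
  have h := (isOrthonormalSample_standardize hX hindep hident hf hL2 hvar hcov
    ).tendstoInDistribution_ljungBox K c
  have hσ : ∀ i, 0 < √Var[fun ω => f i (X 0 ω); μ] := fun i => Real.sqrt_pos.2 (hvar i)
  have haff := fun x N => SerialTest.ljungBox_affine (f := f) hσ
    (b := fun i => ∫ ω, f i (X 0 ω) ∂μ) (fun i y => by
      rw [mul_div_cancel₀ _ (hσ i).ne', sub_add_cancel]) K c x N
  simpa only [haff] using h
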